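/- Let $\mathbb D=\{z\in\mathbb C:|z|<1\}$, and let $\mathcal U$ be the closed unit ball of $H^\infty$, i.e. the set of analytic functions $f$ on $\mathbb D$ with $\sup_{z\in\mathbb D}|f(z)|\le 1$. Write $$\rho(z,w)=\left|\frac{z-w}{1-\overline w z}\right|,\qquad \beta(z,w)=\log\frac{1+\rho(z,w)}{1-\rho(z,w)}$$ for the pseudohyperbolic and hyperbolic distances in $\mathbb D$, and for $f\in\mathcal U$ let $$N(f)=\sup_{z,w\in\mathbb D,\ z\ne w}\frac{\beta(f(z),f(w))}{\beta(z,w)}$$ (if $f$ is a constant of modulus $1$, then $\beta(f(z),f(w))$ is read as $0$). A sequence $Z=\{z_n\}_{n\in\mathbb N}$ of distinct points of $\mathbb D$ is called a sampling sequence for $\mathcal U$ if there exists $\delta>0$ such that, for every $f\in\mathcal U$, $$\sup_{n\ne m}\frac{\beta(f(z_n),f(z_m))}{\beta(z_n,z_m)}\ \ge\ \delta\,N(f).$$ For $R>0$, $Z$ is called $R$-dense in $\mathbb D$ if for every $z\in\mathbb D$ there is an $n$ with $\beta(z_n,z)<R$. Theorem. A sequence $Z=\{z_n\}_{n\in\mathbb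 N}$ of distinct points in $\mathbb D$ is a sampling sequence for $\mathcal U$ if and only if $Z$ is $R$-dense in $\mathbb D$ for some $R>0$. -/

import Mathlib

open scoped ComplexConjugate ENNReal Complex.UnitDisc

namespace DiscSampling

/-- The pseudohyperbolic distance `|(z - w) / (1 - conj w * z)|`. -/
noncomputable def pseudoHypDist (z w : ℂ) : ℝ :=
  ‖(z - w) / (1 - conj w * z)‖

/-- The hyperbolic distance `β(z, w) = log ((1 + ρ(z, w)) / (1 - ρ(z, w)))`, with `ρ` the
pseudohyperbolic distance. For equal points on the unit circle the formula gives `0`. -/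
noncomputable def hypDist (z w : ℂ) : ℝ :=
  Real.log ((1 + pseudoHypDist z w) / (1 - pseudoHypDist z w))

/-- The open hyperbolic disc with center `a` and radius `R`. -/
def hypBall (a : 𝔻) (R : ℝ) : Set 𝔻 :=
  {z | hypDist z a < R}

/-- The closed unit ball of `H^∞`: functions analytic on the open unit disc and bounded there by
`1` in modulus. Values outside the disc are irrelevant. -/
def unitBallHInfty : Set (ℂ → ℂ) :=
  {f | DifferentiableOn ℂ f (Metric.ball 0 1) ∧ ∀ z : 𝔻, ‖f z‖ ≤ 1}

/-- The hyperbolic Lipschitz constant of `f`: the supremum of `β(f z, f w) / β(z, w)` over pairs of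
distinct points of the disc, as an extended nonnegative real. -/
noncomputable def hypLipConst (f : ℂ → ℂ) : ℝ≥0∞ :=
  ⨆ (z : 𝔻) (w : 𝔻) (_ : z ≠ w), ENNReal.ofReal (hypDist (f z) (f w) / hypDist z w)

/-- The supremum of `β(f z_n, f z_m) / β(z_n, z_m)` over `n ≠ m`. -/
noncomputable def hypLipConstOn (Z : ℕ → 𝔻) (f : ℂ → ℂ) : ℝ≥0∞ :=
  ⨆ (n : ℕ) (m : ℕ) (_ : n ≠ m),
    ENNReal.ofReal (hypDist (f (Z n)) (f (Z m)) / hypDist (Z n) (Z m))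

/-- `Z` is sampling for the closed unit ball of `H^∞`. -/
def IsSampling (Z : ℕ → 𝔻) : Prop :=
  ∃ δ : ℝ, 0 < δ ∧
    ∀ f ∈ unitBallHInfty, ENNReal.ofReal δ * hypLipConst f ≤ hypLipConstOn Z f

/-- `Z` is `R`-dense in the disc: it meets every hyperbolic disc of radius `R`. -/
def IsRDense (Z : ℕ → 𝔻) (R : ℝ) : Prop :=
  ∀ z : 𝔻, (Set.range Z ∩ hypBall z R).Nonempty

end DiscSampling

/-!
The functions are compared with the hyperbolic distance through the Schwarz–Pick lemma, and disc
automorphisms move any point to the origin; both are used in either direction.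

*Density implies sampling.* Let `f` be a self-map of the disc with Lipschitz constant `S` on the
`R`-dense sequence `Z`, and compose it with an automorphism so that the result `g` vanishes at
some `Z n₀`. Then `|g|` is bounded on `Z` by `S` times the distance to `Z n₀`. Let `W` be the
supremum of `|g| / (1 + η β(·, Z n₀))`. Every `z` lies within `R` of some `Z n`, so the Schwarz
lemma on the hyperbolic disc of radius `R + 1` about `Z n` bounds `|g z|` by `q < 1` times the
supremum of `|g|` on that disc, up to `2 |g (Z n)|`. For small `η` the weight changes so little
across such a disc that this reads `W ≤ q' W + O(S)` with `q' < 1`; since `g` is bounded, `W` is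
finite and hence `W = O(S)` (`exists_norm_le_of_isRDense`). All constants depend only on `R`.
So `|g| = O(S)` near `Z n₀`, and a further use of the Schwarz lemma bounds the hyperbolic Lipschitz
constant of `f` at scales below `R` by `O(S)` (`exists_hypDist_map_le_of_hypDist_lt`). At larger
scales, passing through points of `Z` suffices (`exists_hypDist_map_le_of_isRDense`).

*Sampling implies density.* The map `z ↦ z / 2` contracts the hyperbolic distance by an arbitrarily
small factor between points close to the unit circle (`hypDist_half_le` and
`exists_norm_sub_le_mul_hypDist`), but not at the origin. If `Z` misses a large hyperbolic disc
about `a`, composing this map with the automorphism that exchanges `a` and `0` gives a function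
whose Lipschitz constant on `Z` is small and whose global one is bounded below
(`exists_isRDense_of_isSampling`).
-/

open Metric Set Real

namespace DiscSampling

/-! ### The pseudohyperbolic distance and the automorphisms of the disc -/

/-- The holomorphic involution of the unit disc that exchanges `a` and `0`. -/
noncomputable def discInvolution (a z : ℂ) : ℂ :=
  (a - z) / (1 - conj a * z)

lemma one_sub_conj_mul_ne_zero {a z : ℂ} (ha : ‖a‖ < 1) (hz : ‖z‖ < 1) :
    1 - conj a * z ≠ 0 := by
  intro h
  have h1 : conj a * z = 1 := (sub_eq_zero.mp h).symm
  have h2 : ‖a‖ * ‖z‖ = 1 := by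
    rw [← RCLike.norm_conj a, ← norm_mul, h1, norm_one]
  nlinarith [norm_nonneg a, norm_nonneg z]

lemma norm_discInvolution (a z : ℂ) : ‖discInvolution a z‖ = pseudoHypDist z a := by
  rw [discInvolution, pseudoHypDist, norm_div, norm_div, norm_sub_rev]

lemma pseudoHypDist_nonneg (z w : ℂ) : 0 ≤ pseudoHypDist z w := norm_nonneg _

@[simp] lemma pseudoHypDist_self (z : ℂ) : pseudoHypDist z z = 0 := by simp [pseudoHypDist]

@[simp] lemma pseudoHypDist_zero_right (z : ℂ) : pseudoHypDist z 0 = ‖z‖ := by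
  simp [pseudoHypDist]

lemma pseudoHypDist_comm (z w : ℂ) : pseudoHypDist z w = pseudoHypDist w z := by
  have h : (1 - conj z * w : ℂ) = conj (1 - conj w * z) := by simp [mul_comm]
  rw [pseudoHypDist, pseudoHypDist, norm_div, norm_div, norm_sub_rev, h, RCLike.norm_conj]

lemma norm_one_sub_conj_mul_sq (z w : ℂ) :
    ‖1 - conj w * z‖ ^ 2 = ‖z - w‖ ^ 2 + (1 - ‖z‖ ^ 2) * (1 - ‖w‖ ^ 2) := by
  simp only [← Complex.normSq_eq_norm_sq, Complex.normSq_apply]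
  simp
  ring

lemma one_sub_pseudoHypDist_sq {z w : ℂ} (hz : ‖z‖ < 1) (hw : ‖w‖ < 1) :
    1 - pseudoHypDist z w ^ 2 =
      (1 - ‖z‖ ^ 2) * (1 - ‖w‖ ^ 2) / ‖1 - conj w * z‖ ^ 2 := by
  have h := norm_ne_zero_iff.mpr (one_sub_conj_mul_ne_zero hw hz)
  rw [pseudoHypDist, norm_div, div_pow, eq_div_iff (pow_ne_zero 2 h), sub_mul,
    div_mul_cancel₀ _ (pow_ne_zero 2 h), norm_one_sub_conj_mul_sq]
  ring

lemma pseudoHypDist_lt_one {z w : ℂ} (hz : ‖z‖ < 1) (hw : ‖w‖ < 1) :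
    pseudoHypDist z w < 1 := by
  have h := norm_pos_iff.mpr (one_sub_conj_mul_ne_zero hw hz)
  have h1 : 0 < 1 - pseudoHypDist z w ^ 2 := by
    rw [one_sub_pseudoHypDist_sq hz hw]
    have : 0 < 1 - ‖z‖ ^ 2 := by nlinarith [norm_nonneg z]
    have : 0 < 1 - ‖w‖ ^ 2 := by nlinarith [norm_nonneg w]
    positivity
  nlinarith [pseudoHypDist_nonneg z w]

lemma norm_discInvolution_lt_one {a z : ℂ} (ha : ‖a‖ < 1) (hz : ‖z‖ < 1) :
    ‖discInvolution a z‖ < 1 := by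
  rw [norm_discInvolution]
  exact pseudoHypDist_lt_one hz ha

@[simp] lemma discInvolution_zero (a : ℂ) : discInvolution a 0 = a := by simp [discInvolution]

@[simp] lemma discInvolution_self (a : ℂ) : discInvolution a a = 0 := by simp [discInvolution]

lemma discInvolution_discInvolution {a z : ℂ} (ha : ‖a‖ < 1) (hz : ‖z‖ < 1) :
    discInvolution a (discInvolution a z) = z := by
  have h := one_sub_conj_mul_ne_zero ha hz
  have h' := one_sub_conj_mul_ne_zero ha ha
  have h2 : 1 - conj a * ((a - z) / (1 - conj a * z)) = (1 - conj a * a) / (1 - conj a * z) := by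
    field_simp
    ring
  rw [discInvolution, discInvolution, h2, div_eq_iff (div_ne_zero h' h), ← mul_div_assoc,
    eq_div_iff h, sub_mul, div_mul_cancel₀ _ h]
  ring

lemma differentiableOn_discInvolution {a : ℂ} (ha : ‖a‖ < 1) :
    DifferentiableOn ℂ (discInvolution a) (ball 0 1) := by
  unfold discInvolution
  refine DifferentiableOn.div (by fun_prop) (by fun_prop) fun z hz => ?_
  exact one_sub_conj_mul_ne_zero ha (mem_ball_zero_iff.mp hz)

lemma mapsTo_discInvolution {a : ℂ} (ha : ‖a‖ < 1) :
    MapsTo (discInvolution a) (ball 0 1) (ball 0 1) := fun z hz => by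
  rw [mem_ball_zero_iff] at hz ⊢
  exact norm_discInvolution_lt_one ha hz

/-- The Schwarz–Pick lemma. -/
lemma pseudoHypDist_map_le {f : ℂ → ℂ} (hd : DifferentiableOn ℂ f (ball 0 1))
    (hf : MapsTo f (ball 0 1) (ball 0 1)) {z w : ℂ} (hz : ‖z‖ < 1) (hw : ‖w‖ < 1) :
    pseudoHypDist (f z) (f w) ≤ pseudoHypDist z w := by
  have hfw : ‖f w‖ < 1 := mem_ball_zero_iff.mp (hf (mem_ball_zero_iff.mpr hw))
  have hF : DifferentiableOn ℂ (discInvolution (f w) ∘ f ∘ discInvolution w) (ball 0 1) :=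
    (differentiableOn_discInvolution hfw).comp
      (hd.comp (differentiableOn_discInvolution hw) (mapsTo_discInvolution hw))
      (hf.comp (mapsTo_discInvolution hw))
  have hm : MapsTo (discInvolution (f w) ∘ f ∘ discInvolution w) (ball 0 1) (closedBall 0 1) :=
    ((mapsTo_discInvolution hfw).comp (hf.comp (mapsTo_discInvolution hw))).mono_right
      ball_subset_closedBall
  have h := Complex.norm_le_norm_of_mapsTo_ball hF hm (by simp)
    (norm_discInvolution_lt_one hw hz)
  simpa [discInvolution_discInvolution hw hz, norm_discInvolution] using h

lemma pseudoHypDist_discInvolution {a z w : ℂ} (ha : ‖a‖ < 1) (hz : ‖z‖ < 1) (hw : ‖w‖ < 1) :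
    pseudoHypDist (discInvolution a z) (discInvolution a w) = pseudoHypDist z w := by
  have hd := differentiableOn_discInvolution ha
  have hm := mapsTo_discInvolution ha
  refine le_antisymm (pseudoHypDist_map_le hd hm hz hw) ?_
  simpa [discInvolution_discInvolution ha hz, discInvolution_discInvolution ha hw] using
    pseudoHypDist_map_le hd hm (norm_discInvolution_lt_one ha hz)
      (norm_discInvolution_lt_one ha hw)

lemma pseudoHypDist_le_norm_add_norm_div {z w : ℂ} (hz : ‖z‖ < 1) (hw : ‖w‖ < 1) :
    pseudoHypDist z w ≤ (‖z‖ + ‖w‖) / (1 + ‖z‖ * ‖w‖) := by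
  have hD := norm_pos_iff.mpr (one_sub_conj_mul_ne_zero hw hz)
  have hDle : ‖1 - conj w * z‖ ≤ 1 + ‖z‖ * ‖w‖ := by
    refine (norm_sub_le _ _).trans ?_
    simp [mul_comm]
  have hz' : 0 < 1 - ‖z‖ ^ 2 := by nlinarith [norm_nonneg z]
  have hw' : 0 < 1 - ‖w‖ ^ 2 := by nlinarith [norm_nonneg w]
  have h1 := one_sub_pseudoHypDist_sq hz hw
  have h2 : (1 - ‖z‖ ^ 2) * (1 - ‖w‖ ^ 2) / (1 + ‖z‖ * ‖w‖) ^ 2 ≤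
      (1 - ‖z‖ ^ 2) * (1 - ‖w‖ ^ 2) / ‖1 - conj w * z‖ ^ 2 := by gcongr
  have h3 : (1 - ‖z‖ ^ 2) * (1 - ‖w‖ ^ 2) / (1 + ‖z‖ * ‖w‖) ^ 2 =
      1 - ((‖z‖ + ‖w‖) / (1 + ‖z‖ * ‖w‖)) ^ 2 := by
    have : 1 + ‖z‖ * ‖w‖ ≠ 0 := by positivity
    field_simp
    ring
  refine le_of_sq_le_sq ?_ (by positivity)
  linarith

/-! ### The hyperbolic distance -/

lemma hypDist_eq_artanh {z w : ℂ} (h : pseudoHypDist z w < 1) :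
    hypDist z w = 2 * artanh (pseudoHypDist z w) := by
  rw [artanh_eq_half_log ⟨by linarith [pseudoHypDist_nonneg z w], h.le⟩, hypDist]
  ring

lemma pseudoHypDist_mem_Ioo {z w : ℂ} (hz : ‖z‖ < 1) (hw : ‖w‖ < 1) :
    pseudoHypDist z w ∈ Ioo (-1) 1 :=
  ⟨by linarith [pseudoHypDist_nonneg z w], pseudoHypDist_lt_one hz hw⟩

lemma hypDist_lt_iff {z w : ℂ} (hz : ‖z‖ < 1) (hw : ‖w‖ < 1) (R : ℝ) :
    hypDist z w < R ↔ pseudoHypDist z w < tanh (R / 2) := by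
  rw [hypDist_eq_artanh (pseudoHypDist_lt_one hz hw),
    ← artanh_lt_artanh_iff (pseudoHypDist_mem_Ioo hz hw) ⟨neg_one_lt_tanh _, tanh_lt_one _⟩,
    artanh_tanh, lt_div_iff₀ two_pos, mul_comm]

lemma hypDist_comm (z w : ℂ) : hypDist z w = hypDist w z := by
  rw [hypDist, hypDist, pseudoHypDist_comm]

@[simp] lemma hypDist_self (z : ℂ) : hypDist z z = 0 := by simp [hypDist]

lemma two_mul_pseudoHypDist_le_hypDist {z w : ℂ} (hz : ‖z‖ < 1) (hw : ‖w‖ < 1) :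
    2 * pseudoHypDist z w ≤ hypDist z w := by
  have h0 := pseudoHypDist_nonneg z w
  have h1 := pseudoHypDist_lt_one hz hw
  have h := le_hasSum (hasSum_log_sub_log_of_abs_lt_one (abs_lt.mpr ⟨by linarith, h1⟩)) 0
    fun k _ => by positivity
  rw [hypDist, log_div (by linarith) (by linarith)]
  simpa using h

lemma hypDist_nonneg {z w : ℂ} (hz : ‖z‖ < 1) (hw : ‖w‖ < 1) : 0 ≤ hypDist z w := by
  linarith [two_mul_pseudoHypDist_le_hypDist hz hw, pseudoHypDist_nonneg z w]

lemma hypDist_pos {z w : ℂ} (hz : ‖z‖ < 1) (hw : ‖w‖ < 1) (h : z ≠ w) : 0 < hypDist z w := by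
  refine lt_of_lt_of_le ?_ (two_mul_pseudoHypDist_le_hypDist hz hw)
  have : 0 < pseudoHypDist z w :=
    norm_pos_iff.mpr (div_ne_zero (sub_ne_zero.mpr h) (one_sub_conj_mul_ne_zero hw hz))
  linarith

lemma hypDist_le_of_pseudoHypDist_le {z w : ℂ} {s : ℝ} (hs : s < 1)
    (h : pseudoHypDist z w ≤ s) : hypDist z w ≤ 2 / (1 - s) * pseudoHypDist z w := by
  have h0 := pseudoHypDist_nonneg z w
  have h1 : 0 < 1 - pseudoHypDist z w := by linarith
  have hs' : 0 < 1 - s := by linarith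
  calc hypDist z w ≤ (1 + pseudoHypDist z w) / (1 - pseudoHypDist z w) - 1 :=
        log_le_sub_one_of_pos (by positivity)
    _ = 2 / (1 - pseudoHypDist z w) * pseudoHypDist z w := by field_simp; ring
    _ ≤ 2 / (1 - s) * pseudoHypDist z w := by gcongr

lemma hypDist_le_hypDist {z w z' w' : ℂ} (hz : ‖z‖ < 1) (hw : ‖w‖ < 1)
    (h : pseudoHypDist z' w' ≤ pseudoHypDist z w) : hypDist z' w' ≤ hypDist z w := by
  have h1 := pseudoHypDist_lt_one hz hw
  rw [hypDist_eq_artanh h1, hypDist_eq_artanh (h.trans_lt h1)]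
  have := artanh_le_artanh (by linarith [pseudoHypDist_nonneg z' w']) h1 h
  linarith

lemma hypDist_discInvolution {a z w : ℂ} (ha : ‖a‖ < 1) (hz : ‖z‖ < 1) (hw : ‖w‖ < 1) :
    hypDist (discInvolution a z) (discInvolution a w) = hypDist z w := by
  rw [hypDist, hypDist, pseudoHypDist_discInvolution ha hz hw]

lemma hypDist_le_add_zero {z w : ℂ} (hz : ‖z‖ < 1) (hw : ‖w‖ < 1) :
    hypDist z w ≤ hypDist z 0 + hypDist w 0 := by
  have hz0 := norm_nonneg z
  have hw0 := norm_nonneg w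
  have hz1 : 0 < 1 - ‖z‖ := by linarith
  have hw1 : 0 < 1 - ‖w‖ := by linarith
  have hp := pseudoHypDist_le_norm_add_norm_div hz hw
  have hr : 0 < 1 - pseudoHypDist z w := by linarith [pseudoHypDist_lt_one hz hw]
  have hr0 := pseudoHypDist_nonneg z w
  rw [hypDist, hypDist, hypDist, pseudoHypDist_zero_right, pseudoHypDist_zero_right,
    ← log_mul (by positivity) (by positivity)]
  refine log_le_log (by positivity) ?_
  rw [div_mul_div_comm, div_le_div_iff₀ hr (by positivity)]
  rw [le_div_iff₀ (by positivity)] at hp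
  nlinarith

lemma hypDist_triangle {a z w : ℂ} (ha : ‖a‖ < 1) (hz : ‖z‖ < 1) (hw : ‖w‖ < 1) :
    hypDist z w ≤ hypDist z a + hypDist a w := by
  have h := hypDist_le_add_zero (norm_discInvolution_lt_one ha hz)
    (norm_discInvolution_lt_one ha hw)
  rw [hypDist_discInvolution ha hz hw, ← discInvolution_self a, hypDist_discInvolution ha hz ha,
    hypDist_discInvolution ha hw ha] at h
  rwa [hypDist_comm a w]

/-! ### Density implies sampling -/

lemma tanh_half_pos {R : ℝ} (hR : 0 < R) : 0 < tanh (R / 2) := by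
  rw [tanh_eq_sinh_div_cosh]
  exact div_pos (sinh_pos_iff.mpr (by linarith)) (cosh_pos _)

lemma tanh_half_lt {R T : ℝ} (h : R < T) : tanh (R / 2) < tanh (T / 2) := by
  rw [← artanh_lt_artanh_iff ⟨neg_one_lt_tanh _, tanh_lt_one _⟩
    ⟨neg_one_lt_tanh _, tanh_lt_one _⟩, artanh_tanh, artanh_tanh]
  linarith

/-- The Schwarz lemma on the hyperbolic disc of radius `T` about `c`, which the involution
`discInvolution c` maps to the Euclidean disc of radius `tanh (T / 2)` about `0`. -/
lemma norm_sub_le_of_norm_le_on_hypBall {g : ℂ → ℂ} (hd : DifferentiableOn ℂ g (ball 0 1))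
    {c : ℂ} (hc : ‖c‖ < 1) {T M : ℝ}
    (hM : ∀ u : ℂ, ‖u‖ < 1 → hypDist u c < T → ‖g u‖ ≤ M) {z : ℂ} (hz : ‖z‖ < 1)
    (hzc : hypDist z c < T) :
    ‖g z - g c‖ ≤ (M + ‖g c‖) / tanh (T / 2) * pseudoHypDist z c := by
  have ht1 : tanh (T / 2) < 1 := tanh_lt_one _
  have hsub : ball (0 : ℂ) (tanh (T / 2)) ⊆ ball 0 1 := ball_subset_ball ht1.le
  have hF : DifferentiableOn ℂ (g ∘ discInvolution c) (ball 0 (tanh (T / 2))) :=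
    (hd.comp (differentiableOn_discInvolution hc) (mapsTo_discInvolution hc)).mono hsub
  have hm : MapsTo (g ∘ discInvolution c) (ball 0 (tanh (T / 2)))
      (closedBall ((g ∘ discInvolution c) 0) (M + ‖g c‖)) := by
    intro u hu
    have hu1 : ‖u‖ < 1 := mem_ball_zero_iff.mp (hsub hu)
    have hcu := norm_discInvolution_lt_one hc hu1
    have h1 : ‖g (discInvolution c u)‖ ≤ M := by
      refine hM _ hcu ((hypDist_lt_iff hcu hc T).mpr ?_)
      rw [← norm_discInvolution, discInvolution_discInvolution hc hu1]
      exact mem_ball_zero_iff.mp hu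
    rw [mem_closedBall, dist_eq_norm]
    simpa using (norm_sub_le _ _).trans (add_le_add_left h1 ‖g c‖)
  have hz' : discInvolution c z ∈ ball (0 : ℂ) (tanh (T / 2)) := by
    rw [mem_ball_zero_iff, norm_discInvolution]
    exact (hypDist_lt_iff hz hc T).mp hzc
  have h := Complex.dist_le_div_mul_dist_of_mapsTo_ball hF hm hz'
  simpa [dist_eq_norm, discInvolution_discInvolution hc hz, norm_discInvolution] using h

/-- A bounded holomorphic function that is small, relative to the distance from a base point, on
an `R`-dense sequence is small in the same sense on the whole disc. Near a point of the sequence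
the Schwarz lemma improves any bound for `g` by a factor less than `1`; the weight
`1 + η * hypDist z a` varies so slowly that the best weighted bound must be controlled by the
values on the sequence. -/
lemma exists_norm_le_of_isRDense {Z : ℕ → 𝔻} {R : ℝ} (hR : 0 < R) (hZ : IsRDense Z R) :
    ∃ C : ℝ, 0 < C ∧ ∀ (g : ℂ → ℂ) (S : ℝ) (a : 𝔻), DifferentiableOn ℂ g (ball 0 1) →
      (∀ z : 𝔻, ‖g z‖ ≤ 1) → 0 ≤ S → (∀ n, ‖g (Z n)‖ ≤ S * hypDist (Z n) a) →
      ∀ z : 𝔻, ‖g z‖ ≤ C * S * (1 + hypDist z a) := by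
  set s := tanh (R / 2) with hs
  set t := tanh ((R + 1) / 2) with ht
  have hs0 : 0 < s := tanh_half_pos hR
  have hst : s < t := tanh_half_lt (by linarith)
  have ht0 : 0 < t := hs0.trans hst
  set q := s / t with hq
  have hq0 : 0 < q := by positivity
  have hq1 : q < 1 := (div_lt_one ht0).mpr hst
  set K := 2 * R + 1 with hK
  have hK0 : 0 < K := by positivity
  set η := (1 - q) / (2 * K) with hη
  have hη0 : 0 < η := div_pos (by linarith) (by positivity)
  have hηK : η * K = (1 - q) / 2 := by rw [hη]; field_simp
  -- This choice of `η` keeps the contraction factor below `1` after changing the weight.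
  have hqη : q * (1 + η * K) ≤ (1 + q) / 2 := by rw [hηK]; nlinarith
  refine ⟨4 * (1 / η + R) / (1 - q) * (1 + η), ?_, fun g S a hd hg hS hgZ z => ?_⟩
  · have : 0 < 1 - q := by linarith
    positivity
  have hb : ∀ z : 𝔻, 0 ≤ hypDist z a := fun z => hypDist_nonneg z.norm_lt_one a.norm_lt_one
  have hw : ∀ z : 𝔻, 0 < 1 + η * hypDist z a := fun z => by
    have := mul_nonneg hη0.le (hb z)
    linarith
  set W := ⨆ z : 𝔻, ‖g z‖ / (1 + η * hypDist z a) with hW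
  have hbdd : BddAbove (range fun z : 𝔻 => ‖g z‖ / (1 + η * hypDist z a)) := by
    refine ⟨1, ?_⟩
    rintro _ ⟨z, rfl⟩
    rw [div_le_one (hw z)]
    have := mul_nonneg hη0.le (hb z)
    linarith [hg z]
  have hle : ∀ z : 𝔻, ‖g z‖ ≤ W * (1 + η * hypDist z a) := fun z =>
    (div_le_iff₀ (hw z)).mp (le_ciSup hbdd z)
  have hW0 : 0 ≤ W := Real.iSup_nonneg fun z => div_nonneg (norm_nonneg _) (hw z).le
  have hself : W ≤ (1 + q) / 2 * W + 2 * S * (1 / η + R) := by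
    refine ciSup_le fun z => (div_le_iff₀ (hw z)).mpr ?_
    obtain ⟨_, ⟨n, rfl⟩, hn⟩ := hZ z
    have hn' : hypDist (Z n) z < R := hn
    have hzn : hypDist z (Z n) < R := by rwa [hypDist_comm]
    set b := hypDist z a with hbdef
    have hb0 : 0 ≤ b := hb z
    have hna : hypDist (Z n) a ≤ R + b := by
      have := hypDist_triangle z.norm_lt_one (Z n).norm_lt_one a.norm_lt_one
      linarith
    have he : ‖g (Z n)‖ ≤ S * (R + b) := (hgZ n).trans (by gcongr)
    have hM : ∀ u : ℂ, ‖u‖ < 1 → hypDist u (Z n) < R + 1 → ‖g u‖ ≤ W * (1 + η * (b + K)) := by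
      intro u hu hun
      refine (hle ⟨u, mem_ball_zero_iff.mpr hu⟩).trans ?_
      have := hypDist_triangle (Z n).norm_lt_one hu a.norm_lt_one
      have h' : hypDist u a ≤ b + K := by rw [hK]; linarith
      change W * (1 + η * hypDist u a) ≤ _
      gcongr
    have hschw := norm_sub_le_of_norm_le_on_hypBall hd (Z n).norm_lt_one hM
      z.norm_lt_one (by linarith)
    have hρ : pseudoHypDist z (Z n) ≤ s :=
      ((hypDist_lt_iff z.norm_lt_one (Z n).norm_lt_one R).mp hzn).le
    have hM0 : 0 ≤ W * (1 + η * (b + K)) := by positivity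
    have h1 : ‖g z - g (Z n)‖ ≤ q * (W * (1 + η * (b + K)) + ‖g (Z n)‖) := by
      refine hschw.trans ?_
      calc _ ≤ (W * (1 + η * (b + K)) + ‖g (Z n)‖) / t * s := by gcongr
        _ = _ := by rw [hq]; ring
    have h2 : ‖g z‖ ≤ ‖g z - g (Z n)‖ + ‖g (Z n)‖ := norm_le_norm_sub_add _ _
    have h3 : q * ‖g (Z n)‖ ≤ ‖g (Z n)‖ := mul_le_of_le_one_left (norm_nonneg _) hq1.le
    have h4 : q * (W * (1 + η * (b + K))) ≤ (1 + q) / 2 * W * (1 + η * b) := by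
      have h5 : 1 + η * (b + K) ≤ (1 + η * K) * (1 + η * b) := by
        have : 0 ≤ η * K * (η * b) := by positivity
        nlinarith
      calc q * (W * (1 + η * (b + K))) ≤ q * (W * ((1 + η * K) * (1 + η * b))) := by gcongr
        _ = q * (1 + η * K) * (W * (1 + η * b)) := by ring
        _ ≤ (1 + q) / 2 * (W * (1 + η * b)) := by gcongr
        _ = _ := by ring
    have h6 : R + b ≤ (1 / η + R) * (1 + η * b) := by
      have : (1 / η + R) * (1 + η * b) = 1 / η + R + b + R * η * b := by
        field_simp
        ring
      rw [this]
      have : 0 ≤ 1 / η + R * η * b := by positivity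
      linarith
    have h7 : S * (R + b) ≤ S * ((1 / η + R) * (1 + η * b)) := by gcongr
    linarith
  have hWle : W ≤ 4 * (1 / η + R) / (1 - q) * S := by
    rw [div_mul_eq_mul_div, le_div_iff₀ (by linarith)]
    linarith
  calc ‖g z‖ ≤ W * (1 + η * hypDist z a) := hle z
    _ ≤ 4 * (1 / η + R) / (1 - q) * S * ((1 + η) * (1 + hypDist z a)) := by
      have := hb z
      have : 0 ≤ η * 1 := by positivity
      gcongr
      nlinarith
    _ = _ := by ring

/-- A holomorphic self-map of the disc that is hyperbolically `S`-Lipschitz on an `R`-dense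
sequence satisfies a Lipschitz bound, with a constant proportional to `S`, for points at
hyperbolic distance less than `R`. -/
lemma exists_hypDist_map_le_of_hypDist_lt {Z : ℕ → 𝔻} {R : ℝ} (hR : 0 < R)
    (hZ : IsRDense Z R) :
    ∃ C : ℝ, 0 < C ∧ ∀ (f : ℂ → ℂ) (S : ℝ), DifferentiableOn ℂ f (ball 0 1) →
      MapsTo f (ball 0 1) (ball 0 1) → 0 ≤ S →
      (∀ n m, hypDist (f (Z n)) (f (Z m)) ≤ S * hypDist (Z n) (Z m)) →
      ∀ z w : 𝔻, hypDist z w < R → hypDist (f z) (f w) ≤ C * S * hypDist z w := by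
  obtain ⟨C, hC, hgrow⟩ := exists_norm_le_of_isRDense hR hZ
  set t := tanh (R / 2) with ht
  have ht0 : 0 < t := tanh_half_pos hR
  have ht1 : 0 < 1 - t := by linarith [tanh_lt_one (R / 2)]
  set D := C * (1 + 2 * R) with hD
  have hD0 : 0 < D := by positivity
  refine ⟨(2 / (1 - t) * (4 / 3 * (2 / t)) + 2) * D, by positivity,
    fun f S hd hf hS hfZ z w hzw => ?_⟩
  have hball : ∀ x : 𝔻, (x : ℂ) ∈ ball (0 : ℂ) 1 := fun x => mem_ball_zero_iff.mpr x.norm_lt_one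
  have hfn : ∀ x : 𝔻, ‖f x‖ < 1 := fun x => mem_ball_zero_iff.mp (hf (hball x))
  have hβ := hypDist_nonneg z.norm_lt_one w.norm_lt_one
  have hSP := pseudoHypDist_map_le hd hf z.norm_lt_one w.norm_lt_one
  rcases le_or_gt (1 / 2) (D * S) with hDS | hDS
  · -- If `S` is bounded below, the Schwarz–Pick lemma is enough.
    have h1 := hypDist_le_hypDist z.norm_lt_one w.norm_lt_one hSP
    have h2 : 1 ≤ (2 / (1 - t) * (4 / 3 * (2 / t)) + 2) * D * S := by
      have : 0 ≤ 2 / (1 - t) * (4 / 3 * (2 / t)) * (D * S) := by positivity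
      linarith
    nlinarith
  obtain ⟨_, ⟨n, rfl⟩, hn⟩ := hZ w
  have hnw : hypDist w (Z n) < R := by rw [hypDist_comm]; exact hn
  set g := discInvolution (f (Z n)) ∘ f with hg
  have hgd : DifferentiableOn ℂ g (ball 0 1) := (differentiableOn_discInvolution (hfn _)).comp hd hf
  have hg1 : ∀ x : 𝔻, ‖g x‖ < 1 := fun x => norm_discInvolution_lt_one (hfn _) (hfn x)
  have hgZ : ∀ m, ‖g (Z m)‖ ≤ S * hypDist (Z m) (Z n) := fun m => by
    have h1 := hfZ m n
    have h2 := two_mul_pseudoHypDist_le_hypDist (hfn (Z m)) (hfn (Z n))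
    have h3 : ‖g (Z m)‖ = pseudoHypDist (f (Z m)) (f (Z n)) := norm_discInvolution _ _
    have h4 := pseudoHypDist_nonneg (f (Z m)) (f (Z n))
    linarith
  have hM : ∀ u : ℂ, ‖u‖ < 1 → hypDist u w < R → ‖g u‖ ≤ D * S := fun u hu huw => by
    refine (hgrow g S (Z n) hgd (fun x => (hg1 x).le) hS hgZ
      ⟨u, mem_ball_zero_iff.mpr hu⟩).trans ?_
    change C * S * (1 + hypDist u (Z n)) ≤ _
    have h1 := hypDist_triangle w.norm_lt_one hu (Z n).norm_lt_one
    calc C * S * (1 + hypDist u (Z n)) ≤ C * S * (1 + 2 * R) := by gcongr; linarith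
      _ = D * S := by rw [hD]; ring
  have hgz := hM z z.norm_lt_one hzw
  have hgw := hM w w.norm_lt_one (by simpa using hR)
  have hschw := norm_sub_le_of_norm_le_on_hypBall hgd w.norm_lt_one hM z.norm_lt_one hzw
  have hinv : pseudoHypDist (g z) (g w) = pseudoHypDist (f z) (f w) :=
    pseudoHypDist_discInvolution (hfn _) (hfn z) (hfn w)
  have hden : 3 / 4 ≤ ‖1 - conj (g w) * g z‖ := by
    have h1 : ‖(1 : ℂ)‖ - ‖conj (g w) * g z‖ ≤ ‖1 - conj (g w) * g z‖ := norm_sub_norm_le _ _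
    rw [norm_one, norm_mul, RCLike.norm_conj] at h1
    have h2 : ‖g w‖ * ‖g z‖ ≤ 1 / 2 * (1 / 2) :=
      mul_le_mul (by linarith) (by linarith) (norm_nonneg _) (by norm_num)
    linarith
  have hρ : pseudoHypDist (f z) (f w) ≤ 4 / 3 * ‖g z - g w‖ := by
    rw [← hinv, pseudoHypDist, norm_div, div_le_iff₀ (by linarith)]
    nlinarith [norm_nonneg (g z - g w)]
  have hρt : pseudoHypDist (f z) (f w) ≤ t :=
    hSP.trans ((hypDist_lt_iff z.norm_lt_one w.norm_lt_one R).mp hzw).le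
  have hρβ : pseudoHypDist z w ≤ hypDist z w := by
    linarith [two_mul_pseudoHypDist_le_hypDist z.norm_lt_one w.norm_lt_one,
      pseudoHypDist_nonneg (z : ℂ) w]
  have hDS0 : 0 ≤ D * S * hypDist z w := by positivity
  calc hypDist (f z) (f w) ≤ 2 / (1 - t) * pseudoHypDist (f z) (f w) :=
        hypDist_le_of_pseudoHypDist_le (by linarith) hρt
    _ ≤ 2 / (1 - t) * (4 / 3 * ((D * S + D * S) / t * hypDist z w)) := by
        gcongr
        refine hρ.trans ?_
        gcongr
        refine hschw.trans ?_
        have := pseudoHypDist_nonneg (z : ℂ) w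
        gcongr
    _ = 2 / (1 - t) * (4 / 3 * (2 / t)) * (D * S * hypDist z w) := by ring
    _ ≤ _ := by linarith

/-- The local bound extends to all pairs of points by the triangle inequality through points of
the sequence. -/
lemma exists_hypDist_map_le_of_isRDense {Z : ℕ → 𝔻} {R : ℝ} (hR : 0 < R) (hZ : IsRDense Z R) :
    ∃ C : ℝ, 0 < C ∧ ∀ (f : ℂ → ℂ) (S : ℝ), DifferentiableOn ℂ f (ball 0 1) →
      MapsTo f (ball 0 1) (ball 0 1) → 0 ≤ S →
      (∀ n m, hypDist (f (Z n)) (f (Z m)) ≤ S * hypDist (Z n) (Z m)) →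
      ∀ z w : 𝔻, hypDist (f z) (f w) ≤ C * S * hypDist z w := by
  obtain ⟨C, hC, hloc⟩ := exists_hypDist_map_le_of_hypDist_lt hR hZ
  refine ⟨2 * C + 3, by positivity, fun f S hd hf hS hfZ z w => ?_⟩
  have hfn : ∀ x : 𝔻, ‖f x‖ < 1 := fun x =>
    mem_ball_zero_iff.mp (hf (mem_ball_zero_iff.mpr x.norm_lt_one))
  have hβ := hypDist_nonneg z.norm_lt_one w.norm_lt_one
  have hloc := hloc f S hd hf hS hfZ
  have hCS : 0 ≤ C * S := by positivity
  rcases lt_or_ge (hypDist z w) R with h | h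
  · refine (hloc z w h).trans ?_
    nlinarith [mul_nonneg hCS hβ, mul_nonneg hS hβ]
  obtain ⟨_, ⟨n, rfl⟩, hn⟩ := hZ z
  obtain ⟨_, ⟨m, rfl⟩, hm⟩ := hZ w
  have hn : hypDist (Z n) z < R := hn
  have hm : hypDist (Z m) w < R := hm
  have h1 := hloc (Z n) z hn
  have h2 := hloc (Z m) w hm
  have h3 := hfZ n m
  have h4 := hypDist_triangle (hfn (Z n)) (hfn z) (hfn w)
  have h5 := hypDist_triangle (hfn (Z m)) (hfn (Z n)) (hfn w)
  have h6 := hypDist_triangle z.norm_lt_one (Z n).norm_lt_one (Z m).norm_lt_one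
  have h7 := hypDist_triangle w.norm_lt_one z.norm_lt_one (Z m).norm_lt_one
  rw [hypDist_comm (f z) (f (Z n))] at h4
  rw [hypDist_comm w] at h7
  have h8 : C * S * hypDist (Z n) z ≤ C * S * hypDist z w := by gcongr; linarith
  have h9 : C * S * hypDist (Z m) w ≤ C * S * hypDist z w := by gcongr; linarith
  have h10 : S * hypDist (Z n) (Z m) ≤ S * (3 * hypDist z w) := by gcongr; linarith
  linarith

lemma eqOn_const_or_mapsTo_of_mem_unitBallHInfty {f : ℂ → ℂ} (hf : f ∈ unitBallHInfty) :
    (∃ c, EqOn f (fun _ => c) (ball 0 1)) ∨ MapsTo f (ball 0 1) (ball 0 1) := by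
  by_cases h : MapsTo f (ball 0 1) (ball 0 1)
  · exact Or.inr h
  left
  obtain ⟨hd, hb⟩ := hf
  simp only [MapsTo, not_forall] at h
  obtain ⟨z, hz, hfz⟩ := h
  rw [mem_ball_zero_iff, not_lt] at hfz
  refine ⟨f z, Complex.eqOn_of_isPreconnected_of_isMaxOn_norm
    (convex_ball 0 1).isPreconnected isOpen_ball hd hz fun w hw => ?_⟩
  exact (hb ⟨w, hw⟩).trans hfz

lemma isSampling_of_isRDense {Z : ℕ → 𝔻} (hZinj : Function.Injective Z) {R : ℝ} (hR : 0 < R)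
    (hZ : IsRDense Z R) : IsSampling Z := by
  obtain ⟨C, hC, hlip⟩ := exists_hypDist_map_le_of_isRDense hR hZ
  refine ⟨C⁻¹, inv_pos.mpr hC, fun f hf => ?_⟩
  rcases eqOn_const_or_mapsTo_of_mem_unitBallHInfty hf with ⟨c, hc⟩ | hmap
  · have h0 : hypLipConst f = 0 := by
      simp only [hypLipConst, ENNReal.iSup_eq_zero]
      intro z w _
      rw [hc (mem_ball_zero_iff.mpr z.norm_lt_one), hc (mem_ball_zero_iff.mpr w.norm_lt_one)]
      simp
    simp [h0]
  by_cases htop : hypLipConstOn Z f = ⊤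
  · simp [htop]
  have hS : ∀ n m, hypDist (f (Z n)) (f (Z m)) ≤
      (hypLipConstOn Z f).toReal * hypDist (Z n) (Z m) := by
    intro n m
    rcases eq_or_ne n m with rfl | hnm
    · simp
    have hpos := hypDist_pos (Z n).norm_lt_one (Z m).norm_lt_one
      (fun h => hnm (hZinj (Complex.UnitDisc.coe_injective h)))
    rw [← div_le_iff₀ hpos]
    refine (ENNReal.ofReal_le_iff_le_toReal htop).mp ?_
    exact le_iSup_of_le n (le_iSup_of_le m (le_iSup_of_le hnm le_rfl))
  have hN : hypLipConst f ≤ ENNReal.ofReal (C * (hypLipConstOn Z f).toReal) := by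
    refine iSup_le fun z => iSup_le fun w => iSup_le fun hzw => ENNReal.ofReal_le_ofReal ?_
    rw [div_le_iff₀ (hypDist_pos z.norm_lt_one w.norm_lt_one
      (fun h => hzw (Complex.UnitDisc.coe_injective h)))]
    exact hlip f _ hf.1 hmap ENNReal.toReal_nonneg hS z w
  calc ENNReal.ofReal C⁻¹ * hypLipConst f
      ≤ ENNReal.ofReal C⁻¹ * ENNReal.ofReal (C * (hypLipConstOn Z f).toReal) := by gcongr
    _ = hypLipConstOn Z f := by
      rw [← ENNReal.ofReal_mul (inv_pos.mpr hC).le, inv_mul_cancel_left₀ hC.ne',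
        ENNReal.ofReal_toReal htop]

/-! ### Sampling implies density -/

lemma hypDist_half_le {z w : ℂ} (hz : ‖z‖ < 1) (hw : ‖w‖ < 1) :
    hypDist (z / 2) (w / 2) ≤ 7 * ‖z - w‖ := by
  have hz2 : ‖z / 2‖ = ‖z‖ / 2 := by simp
  have hw2 : ‖w / 2‖ = ‖w‖ / 2 := by simp
  have hz0 := norm_nonneg z
  have hw0 := norm_nonneg w
  have h1 : pseudoHypDist (z / 2) (w / 2) ≤ 4 / 5 := by
    refine (pseudoHypDist_le_norm_add_norm_div (by linarith) (by linarith)).trans ?_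
    rw [hz2, hw2, div_le_div_iff₀ (by positivity) (by norm_num)]
    nlinarith [mul_nonneg (sub_nonneg.mpr hz.le) (sub_nonneg.mpr hw.le)]
  have hden : 3 / 4 ≤ ‖1 - conj (w / 2) * (z / 2)‖ := by
    have h1 := norm_sub_norm_le (1 : ℂ) (conj (w / 2) * (z / 2))
    rw [norm_one, norm_mul, RCLike.norm_conj, hz2, hw2] at h1
    nlinarith
  have h2 : pseudoHypDist (z / 2) (w / 2) ≤ 2 / 3 * ‖z - w‖ := by
    rw [pseudoHypDist, norm_div, div_le_iff₀ (by linarith), ← sub_div, norm_div,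
      Complex.norm_ofNat]
    nlinarith [norm_nonneg (z - w)]
  refine (hypDist_le_of_pseudoHypDist_le (by norm_num) h1).trans ?_
  linarith [norm_nonneg (z - w)]

/-- Near the unit circle the Euclidean distance is negligible compared with the hyperbolic
distance. -/
lemma exists_norm_sub_le_mul_hypDist {ε : ℝ} (hε : 0 < ε) :
    ∃ r : ℝ, 0 < r ∧ r < 1 ∧ ∀ z w : ℂ, ‖z‖ < 1 → ‖w‖ < 1 → r ≤ ‖z‖ → r ≤ ‖w‖ →
      ‖z - w‖ ≤ ε * hypDist z w := by
  set κ := min (1 / 2) (ε * exp (-(1 / ε)) / 2) with hκ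
  have hκ0 : 0 < κ := by positivity
  have hκ1 : κ ≤ 1 / 2 := min_le_left _ _
  have hκ2 : 2 * κ ≤ ε * exp (-(1 / ε)) := by
    linarith [min_le_right (1 / 2) (ε * exp (-(1 / ε)) / 2)]
  refine ⟨1 - κ, by linarith, by linarith, fun z w hz hw hrz hrw => ?_⟩
  have hden := norm_pos_iff.mpr (one_sub_conj_mul_ne_zero hw hz)
  have hρ0 := pseudoHypDist_nonneg z w
  have hρ1 := pseudoHypDist_lt_one hz hw
  have h2ρ := two_mul_pseudoHypDist_le_hypDist hz hw
  have hβ := hypDist_nonneg hz hw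
  rcases le_or_gt ‖1 - conj w * z‖ ε with h | h
  · -- Here `‖z - w‖ = ρ * ‖1 - conj w * z‖` is small compared with `ρ`.
    have h1 : ‖z - w‖ = pseudoHypDist z w * ‖1 - conj w * z‖ := by
      rw [pseudoHypDist, norm_div, div_mul_cancel₀ _ hden.ne']
    rw [h1, mul_comm]
    exact mul_le_mul h (by linarith) hρ0 hε.le
  · -- Here `ρ` is close to `1`, so the hyperbolic distance is large.
    have hz2 : 1 - ‖z‖ ^ 2 ≤ 2 * κ := by nlinarith
    have hw2 : 1 - ‖w‖ ^ 2 ≤ 2 * κ := by nlinarith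
    have hz0 : 0 < 1 - ‖z‖ ^ 2 := by nlinarith [norm_nonneg z]
    have hw0 : 0 < 1 - ‖w‖ ^ 2 := by nlinarith [norm_nonneg w]
    have h1 : 1 - pseudoHypDist z w ^ 2 ≤ exp (-(2 / ε)) := by
      rw [one_sub_pseudoHypDist_sq hz hw]
      calc (1 - ‖z‖ ^ 2) * (1 - ‖w‖ ^ 2) / ‖1 - conj w * z‖ ^ 2
          ≤ (ε * exp (-(1 / ε))) * (ε * exp (-(1 / ε))) / ε ^ 2 := by
            gcongr <;> linarith
        _ = exp (-(1 / ε)) * exp (-(1 / ε)) := by field_simp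
        _ = exp (-(2 / ε)) := by rw [← exp_add]; congr 1; ring
    have h2 : 2 / ε ≤ hypDist z w := by
      have h3 : 0 < 1 - pseudoHypDist z w := by linarith
      rw [hypDist, le_log_iff_exp_le (by positivity), le_div_iff₀ h3]
      have h4 : exp (2 / ε) * exp (-(2 / ε)) = 1 := by rw [← exp_add]; simp
      have h5 := mul_le_mul_of_nonneg_left h1 (exp_pos (2 / ε)).le
      rw [h4] at h5
      have h6 : exp (2 / ε) * (1 - pseudoHypDist z w) * (1 + pseudoHypDist z w) ≤ 1 := by
        calc _ = exp (2 / ε) * (1 - pseudoHypDist z w ^ 2) := by ring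
          _ ≤ 1 := h5
      have h7 : 0 < exp (2 / ε) * (1 - pseudoHypDist z w) := by positivity
      nlinarith
    have h3 : ‖z - w‖ ≤ 2 := by linarith [norm_sub_le z w]
    calc ‖z - w‖ ≤ 2 := h3
      _ = ε * (2 / ε) := by field_simp
      _ ≤ ε * hypDist z w := by gcongr

/-- If the sequence avoids large hyperbolic discs, sampling fails for the functions
`discInvolution a / 2`, where `a` is the center of such a disc. -/
lemma exists_isRDense_of_isSampling {Z : ℕ → 𝔻} (hZinj : Function.Injective Z)
    (hZ : IsSampling Z) : ∃ R : ℝ, 0 < R ∧ IsRDense Z R := by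
  obtain ⟨δ, hδ, hsamp⟩ := hZ
  -- The value at the pair `1 / 2`, `0` of the quotient in the Lipschitz constant of `z / 2`.
  set c := hypDist (1 / 4) 0 / hypDist (1 / 2) 0 with hc
  have hc0 : 0 < c := div_pos (hypDist_pos (by norm_num) (by norm_num) (by norm_num))
    (hypDist_pos (by norm_num) (by norm_num) (by norm_num))
  have hε : 0 < δ * c / 14 := by positivity
  obtain ⟨r, hr0, hr1, hr⟩ := exists_norm_sub_le_mul_hypDist hε
  refine ⟨2 * artanh r, by linarith [artanh_pos (x := r) ⟨hr0, hr1⟩], fun a => ?_⟩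
  by_contra hemp
  have hfar : ∀ n, r ≤ ‖discInvolution a (Z n)‖ := fun n => by
    by_contra hlt
    refine hemp ⟨Z n, ⟨n, rfl⟩, ?_⟩
    change hypDist (Z n) a < _
    rw [hypDist_lt_iff (Z n).norm_lt_one a.norm_lt_one, mul_div_cancel_left₀ _ two_ne_zero,
      tanh_artanh ⟨by linarith, hr1⟩, ← norm_discInvolution]
    exact not_le.mp hlt
  set f : ℂ → ℂ := fun z => discInvolution a z / 2 with hf
  have hfU : f ∈ unitBallHInfty := by
    refine ⟨(differentiableOn_discInvolution a.norm_lt_one).div_const 2, fun z => ?_⟩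
    have := norm_discInvolution_lt_one a.norm_lt_one z.norm_lt_one
    rw [hf, norm_div, Complex.norm_ofNat]
    linarith
  have hup : hypLipConstOn Z f ≤ ENNReal.ofReal (δ * c / 2) := by
    refine iSup_le fun n => iSup_le fun m => iSup_le fun hnm => ENNReal.ofReal_le_ofReal ?_
    rw [div_le_iff₀ (hypDist_pos (Z n).norm_lt_one (Z m).norm_lt_one
      (fun h => hnm (hZinj (Complex.UnitDisc.coe_injective h))))]
    have hn := norm_discInvolution_lt_one a.norm_lt_one (Z n).norm_lt_one
    have hm := norm_discInvolution_lt_one a.norm_lt_one (Z m).norm_lt_one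
    have h1 := hypDist_half_le hn hm
    have h2 := hr _ _ hn hm (hfar n) (hfar m)
    rw [hypDist_discInvolution a.norm_lt_one (Z n).norm_lt_one (Z m).norm_lt_one] at h2
    simp only [hf]
    linarith
  have hlow : ENNReal.ofReal c ≤ hypLipConst f := by
    have hhalf : ‖(1 / 2 : ℂ)‖ < 1 := by norm_num
    have hp := norm_discInvolution_lt_one a.norm_lt_one hhalf
    have hinv := discInvolution_discInvolution a.norm_lt_one hhalf
    have hdist : hypDist (discInvolution a (1 / 2)) a = hypDist (1 / 2) 0 := by
      have := hypDist_discInvolution a.norm_lt_one hhalf (w := 0) (by simp)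
      rwa [discInvolution_zero] at this
    have hne : (⟨discInvolution a (1 / 2), mem_ball_zero_iff.mpr hp⟩ : 𝔻) ≠ a := fun h => by
      have h' : discInvolution a (1 / 2) = a := congrArg Complex.UnitDisc.coe h
      rw [h', discInvolution_self] at hinv
      norm_num at hinv
    refine le_iSup_of_le ⟨discInvolution a (1 / 2), mem_ball_zero_iff.mpr hp⟩
      (le_iSup_of_le a (le_iSup_of_le hne (ENNReal.ofReal_le_ofReal ?_)))
    change c ≤ hypDist (f (discInvolution a (1 / 2))) (f a) / hypDist (discInvolution a (1 / 2)) a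
    have hf1 : f (discInvolution a (1 / 2)) = 1 / 4 := by simp only [hf, hinv]; norm_num
    have hf2 : f a = 0 := by simp [hf]
    rw [hf1, hf2, hdist]
  have h : ENNReal.ofReal (δ * c) ≤ ENNReal.ofReal (δ * c / 2) := by
    rw [ENNReal.ofReal_mul hδ.le]
    exact (mul_le_mul_right hlow _).trans ((hsamp f hfU).trans hup)
  have h' := (ENNReal.ofReal_le_ofReal_iff (by positivity)).mp h
  linarith [mul_pos hδ hc0]

end DiscSampling

theorem mainTheorem1 (Z : ℕ → Complex.UnitDisc) (hZ : Function.Injective Z) :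
    DiscSampling.IsSampling Z ↔ ∃ R : ℝ, 0 < R ∧ DiscSampling.IsRDense Z R :=
  ⟨DiscSampling.exists_isRDense_of_isSampling hZ,
    fun ⟨_, hR, h⟩ => DiscSampling.isSampling_of_isRDense hZ hR h⟩
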